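/- Let $k(x,x')=\exp(-|x-x'|)$ be the Laplace kernel on $\mathbb{R}$, let $\mathcal{H}$ be its reproducing kernel Hilbert space (a space of functions $\mathbb{R}\to\mathbb{R}$), and let $\mathcal{F}=\mathcal{H}\oplus\mathbb{R}=\{f'+b : f'\in\mathcal{H},\ b\in\mathbb{R}\}$. Then $\mathcal{F}$ is closed under Lipschitz post-processing: (i) for every $f\in\mathcal{F}$ with values in $[0,1]$ and every $1$-Lipschitz function $h:[0,1]\to[-1,1]$, the function $f+h\circ f$ belongs to $\mathcal{F}$; (ii) likewise, for every $f\in\mathcal{F}$ (with no restriction on its values) and every $1$-Lipschitz function $h:\mathbb{R}\to[-1,1]$, the function $f+h\circ f$ belongs to $\mathcal{F}$. -/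

import Mathlib

open Set MeasureTheory
open scoped InnerProductSpace NNReal

noncomputable section

/-- The Laplace kernel `k(x, x') = exp (-|x - x'|)` on `ℝ`. -/
def laplaceKernel (x x' : ℝ) : ℝ := Real.exp (-|x - x'|)

/-- A real-valued kernel `k : ℝ × ℝ → ℝ` in the format in which Mathlib takes the kernel of a
reproducing kernel Hilbert space of functions `ℝ → ℝ`: the real number `k x x'` is identified
with the operator `v ↦ k x x' * v` on `ℝ`. -/
def kernelMatrix (k : ℝ → ℝ → ℝ) : Matrix ℝ ℝ (ℝ →L[ℝ] ℝ) :=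
  Matrix.of fun x x' => k x x' • ContinuousLinearMap.id ℝ ℝ

/-- A kernel that is given by a feature map is positive semidefinite. -/
theorem posSemidef_kernelMatrix_of_feature {E : Type*} [NormedAddCommGroup E]
    [InnerProductSpace ℝ E] (k : ℝ → ℝ → ℝ) (φ : ℝ → E) (h : ∀ x x', ⟪φ x, φ x'⟫_ℝ = k x x') :
    (kernelMatrix k).PosSemidef := by
  have hsymm : ∀ x x', k x x' = k x' x := fun x x' => by
    rw [← h, ← h, real_inner_comm]
  have tfae := (RKHS.posSemidef_tfae (𝕜 := ℝ) (K := kernelMatrix k)).out 0 2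
  refine tfae.mpr ⟨?_, fun v => ?_⟩
  · ext x x'
    have hid : star (ContinuousLinearMap.id ℝ ℝ) = ContinuousLinearMap.id ℝ ℝ :=
      star_one (ℝ →L[ℝ] ℝ)
    simp [kernelMatrix, Matrix.conjTranspose_apply, hsymm x x', hid]
  · have key : (v.sum fun x w => v.sum fun x' w' => ⟪kernelMatrix k x' x w, w'⟫_ℝ)
        = ⟪v.sum fun x w => w • φ x, v.sum fun x w => w • φ x⟫_ℝ := by
      simp only [Finsupp.sum, sum_inner, inner_sum, inner_smul_left, inner_smul_right, h,
        kernelMatrix]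
      refine Finset.sum_congr rfl fun x _ => ?_
      rw [Finset.mul_sum]
      refine Finset.sum_congr rfl fun x' _ => ?_
      simp
      ring
    rw [key]
    exact real_inner_self_nonneg

/-- The Laplace kernel is positive semidefinite. -/
theorem posSemidef_laplaceKernel : (kernelMatrix laplaceKernel).PosSemidef := by
  refine posSemidef_kernelMatrix_of_feature laplaceKernel
    (fun x => Real.exp (-x) • indicatorConstLp (μ := (volume : Measure ℝ)) 2
      (measurableSet_Ioc (a := (0 : ℝ)) (b := Real.exp (2 * x))) (by simp) (1 : ℝ))
    fun x x' => ?_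
  rw [real_inner_smul_left, real_inner_smul_right,
    L2.real_inner_indicatorConstLp_one_indicatorConstLp_one _ _ (by simp) (by simp), Ioc_inter_Ioc, max_self,
    Real.volume_real_Ioc_of_le (le_min (Real.exp_pos _).le (Real.exp_pos _).le), sub_zero,
    laplaceKernel]
  rcases le_total x x' with hx | hx
  · rw [min_eq_left (Real.exp_le_exp.mpr (by linarith)), ← Real.exp_add, ← Real.exp_add,
      abs_of_nonpos (by linarith)]
    congr 1
    ring
  · rw [min_eq_right (Real.exp_le_exp.mpr (by linarith)), ← Real.exp_add, ← Real.exp_add,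
      abs_of_nonneg (by linarith)]
    congr 1
    ring

instance instFactPosSemidefLaplaceKernel : Fact (kernelMatrix laplaceKernel).PosSemidef :=
  ⟨posSemidef_laplaceKernel⟩

/-- The reproducing kernel Hilbert space `H` of the Laplace kernel on `ℝ`: a Hilbert space of
functions `ℝ → ℝ` whose reproducing kernel is the Laplace kernel. -/
abbrev LaplaceRKHS : Type := RKHS.OfKernel (kernelMatrix laplaceKernel)

/-- The class `F = H ⊕ ℝ = {f' + b | f' ∈ H, b ∈ ℝ}` of functions `ℝ → ℝ`. -/
def laplaceClass : Set (ℝ → ℝ) :=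
  {f | ∃ (f' : LaplaceRKHS) (b : ℝ), ∀ x, f x = f' x + b}

/-- The 1-Lipschitz functions from `I ⊆ ℝ` to `[-1, 1]`. -/
def Lip1 (I : Set ℝ) : Set (I → Icc (-1 : ℝ) 1) := {h | LipschitzWith 1 h}

end

/-! Write `f = g + b` with `g` in the RKHS. Then `φ ∘ f - φ b` is a normal contraction of `g`:
neither its absolute values nor its increments exceed those of `g`. So it suffices that the RKHS is
stable under normal contractions, as for a Dirichlet form. On a finite set, the Markov property of
the kernel makes the squared norm of the minimal interpolant a sum over consecutive points, whose
terms regroup into nonnegative multiples of squared values and squared increments. A contraction `w`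
of `g` thus has interpolants of norm at most `‖g‖` on every finite set, and weak-* compactness
yields one for all points. -/

/-- In a Hilbert space, prescribed inner products with a family of vectors are attained by a vector
as soon as any finitely many of them are attained by vectors of uniformly bounded norm. -/
theorem exists_forall_inner_eq_of_finset {E ι : Type*} [NormedAddCommGroup E]
    [InnerProductSpace ℝ E] [CompleteSpace E] (k : ι → E) (u : ι → ℝ) (C : ℝ)
    (h : ∀ s : Finset ι, ∃ v : E, ‖v‖ ≤ C ∧ ∀ i ∈ s, ⟪k i, v⟫_ℝ = u i) :
    ∃ v : E, ∀ i, ⟪k i, v⟫_ℝ = u i := by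
  -- Banach–Alaoglu, with the finite intersection property for the closed conditions `l (k i) = u
  -- i`.
  have hne := (WeakDual.isCompact_closedBall (0 : StrongDual ℝ E) C).inter_iInter_nonempty
    (fun i => {l : WeakDual ℝ E | l (k i) = u i})
    (fun i => isClosed_eq (WeakDual.eval_continuous (k i)) continuous_const)
    (fun s => by
      obtain ⟨v, hv, hvs⟩ := h s
      refine ⟨StrongDual.toWeakDual (InnerProductSpace.toDual ℝ E v), ?_, ?_⟩
      · simpa using hv
      · simp only [mem_iInter, mem_ofPred_eq, StrongDual.coe_toWeakDual]
        intro i hi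
        rw [← hvs i hi, real_inner_comm]
        rfl)
  obtain ⟨l, -, hl⟩ := hne
  refine ⟨(InnerProductSpace.toDual ℝ E).symm (WeakDual.toStrongDual l), fun i => ?_⟩
  rw [real_inner_comm, InnerProductSpace.toDual_symm_apply]
  exact mem_iInter.mp hl i

/-- `v` has the inner products `u` with the vectors `k x`, `x ∈ s`, and is orthogonal to every
vector orthogonal to all of these: it is the interpolant of `u` of minimal norm. -/
def IsMinimalInterpolant {E ι : Type*} [NormedAddCommGroup E] [InnerProductSpace ℝ E]
    (k : ι → E) (s : Finset ι) (u : ι → ℝ) (v : E) : Prop :=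
  (∀ x ∈ s, ⟪k x, v⟫_ℝ = u x) ∧ ∀ z, (∀ x ∈ s, ⟪k x, z⟫_ℝ = 0) → ⟪v, z⟫_ℝ = 0

theorem IsMinimalInterpolant.norm_sq_le {E ι : Type*} [NormedAddCommGroup E]
    [InnerProductSpace ℝ E] {k : ι → E} {s : Finset ι} {u : ι → ℝ} {v g : E}
    (hv : IsMinimalInterpolant k s u v) (hg : ∀ x ∈ s, ⟪k x, g⟫_ℝ = u x) :
    ‖v‖ ^ 2 ≤ ‖g‖ ^ 2 := by
  have h0 : ⟪v, g - v⟫_ℝ = 0 := hv.2 _ fun x hx => by rw [inner_sub_right, hg x hx, hv.1 x hx, sub_self]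
  have h1 := norm_add_sq_real v (g - v)
  rw [h0, add_sub_cancel] at h1
  nlinarith [sq_nonneg ‖g - v‖]

/-- Appending a point on the right of `s` to a minimal interpolation problem for the Laplace
kernel: by the Markov property only the value at the greatest point of `s` matters. -/
theorem IsMinimalInterpolant.exists_insert {E : Type*} [NormedAddCommGroup E]
    [InnerProductSpace ℝ E] {k : ℝ → E} (hk : ∀ x y, ⟪k x, k y⟫_ℝ = laplaceKernel x y)
    {s : Finset ℝ} {u : ℝ → ℝ} {v : E} (hv : IsMinimalInterpolant k s u v) {m a : ℝ}
    (hm : IsGreatest (s : Set ℝ) m) (ha : m < a) :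
    ∃ v', IsMinimalInterpolant k (insert a s) u v' ∧ ‖v'‖ ^ 2 =
      ‖v‖ ^ 2 + (u a - Real.exp (m - a) * u m) ^ 2 / (1 - Real.exp (m - a) ^ 2) := by
  set r := Real.exp (m - a) with hr
  have hr0 : 0 < r := Real.exp_pos _
  have hr1 : r < 1 := by simpa [hr] using ha
  have hne : 1 - r ^ 2 ≠ 0 := by nlinarith
  -- The part of `k a` orthogonal to all `k x`, `x ∈ s`: for `x ≤ m < a` the kernel factors as `exp
  -- (x - a) = r * exp (x - m)`.
  set d := k a - r • k m with hd
  have hsd : ∀ x ∈ s, ⟪k x, d⟫_ℝ = 0 := fun x hx => by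
    have hxm : x ≤ m := hm.2 hx
    rw [hd, inner_sub_right, real_inner_smul_right, hk, hk, laplaceKernel, laplaceKernel,
      abs_of_nonpos (by linarith), abs_of_nonpos (by linarith), hr, ← Real.exp_add, sub_eq_zero]
    congr 1
    ring
  have had : ⟪k a, d⟫_ℝ = 1 - r ^ 2 := by
    rw [hd, inner_sub_right, real_inner_smul_right, hk, hk, laplaceKernel, laplaceKernel,
      abs_of_pos (sub_pos.mpr ha), sub_self, abs_zero, neg_zero, Real.exp_zero, neg_sub, ← hr, sq]
  have hvd : ⟪v, d⟫_ℝ = 0 := hv.2 d hsd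
  have hav : ⟪k a, v⟫_ℝ = r * u m := by
    rw [hd, inner_sub_right, real_inner_smul_right, real_inner_comm, real_inner_comm (k m),
      hv.1 m hm.1] at hvd
    linarith
  have hdd : ‖d‖ ^ 2 = 1 - r ^ 2 := by
    rw [← real_inner_self_eq_norm_sq]
    nth_rw 1 [hd]
    rw [inner_sub_left, real_inner_smul_left, had, hsd m hm.1, mul_zero, sub_zero]
  refine ⟨v + ((u a - r * u m) / (1 - r ^ 2)) • d, ⟨?_, ?_⟩, ?_⟩
  · intro x hx
    rw [inner_add_right, real_inner_smul_right]
    rcases Finset.mem_insert.mp hx with rfl | hx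
    · rw [hav, had, div_mul_cancel₀ _ hne, add_sub_cancel]
    · rw [hv.1 x hx, hsd x hx, mul_zero, add_zero]
  · intro z hz
    have hzs : ∀ x ∈ s, ⟪k x, z⟫_ℝ = 0 := fun x hx => hz x (Finset.mem_insert_of_mem hx)
    rw [inner_add_left, real_inner_smul_left, hv.2 z hzs, hd, inner_sub_left,
      real_inner_smul_left, hz a (Finset.mem_insert_self a s), hzs m hm.1]
    ring
  · rw [norm_add_sq_real, real_inner_smul_right, hvd, norm_smul, mul_pow, hdd, Real.norm_eq_abs,
      sq_abs]
    field_simp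
    ring

/-- The quadratic form of the Laplace kernel at two consecutive points, split into a multiple of
the squared difference and nonnegative multiples of the squared values. -/
theorem sub_mul_sq_div_one_sub_sq {r : ℝ} (h0 : 0 < r) (h1 : r < 1) (a b : ℝ) :
    (a - r * b) ^ 2 / (1 - r ^ 2) = r / (1 - r ^ 2) * (a - b) ^ 2
      + (1 - r) / (2 * (1 + r)) * (a ^ 2 + b ^ 2) + a ^ 2 / 2 - b ^ 2 / 2 := by
  have h2 : 1 - r ≠ 0 := by linarith
  have h3 : 1 + r ≠ 0 := by linarith
  rw [show 1 - r ^ 2 = (1 - r) * (1 + r) by ring]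
  field_simp
  ring

/-- Minimal interpolation for the Laplace kernel decreases under normal contractions. The correction
by half the squared value at the last point makes the estimate hereditary under appending points. -/
theorem exists_isMinimalInterpolant_contraction {E : Type*} [NormedAddCommGroup E]
    [InnerProductSpace ℝ E] {k : ℝ → E} (hk : ∀ x y, ⟪k x, k y⟫_ℝ = laplaceKernel x y)
    {u w : ℝ → ℝ} (hw : ∀ x, |w x| ≤ |u x|) (hd : ∀ x y, |w x - w y| ≤ |u x - u y|)
    (s : Finset ℝ) : ∀ m, IsGreatest (s : Set ℝ) m →
      ∃ v v', IsMinimalInterpolant k s u v ∧ IsMinimalInterpolant k s w v' ∧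
        ‖v'‖ ^ 2 - w m ^ 2 / 2 ≤ ‖v‖ ^ 2 - u m ^ 2 / 2 := by
  induction s using Finset.induction_on_max with
  | empty => exact fun m hm => absurd hm.1 (by simp)
  | insert a s has ih =>
    intro m hm
    obtain rfl : m = a := by
      refine hm.unique ⟨by simp, fun x hx => ?_⟩
      rcases Finset.mem_insert.mp hx with rfl | hx
      · exact le_rfl
      · exact (has x hx).le
    rcases s.eq_empty_or_nonempty with rfl | hs
    · have hkm : ⟪k m, k m⟫_ℝ = 1 := by rw [hk]; simp [laplaceKernel]
      have hnorm : ‖k m‖ ^ 2 = 1 := by rw [← real_inner_self_eq_norm_sq, hkm]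
      have base : ∀ f : ℝ → ℝ, IsMinimalInterpolant k (insert m ∅) f (f m • k m) := fun f =>
        ⟨by simp [real_inner_smul_right, hnorm], fun z hz => by
          rw [real_inner_smul_left, hz m (Finset.mem_insert_self m ∅), mul_zero]⟩
      refine ⟨_, _, base u, base w, ?_⟩
      rw [norm_smul, norm_smul, mul_pow, mul_pow, hnorm, Real.norm_eq_abs, Real.norm_eq_abs,
        sq_abs, sq_abs]
      linarith [sq_le_sq.mpr (hw m)]
    · have hb := s.isGreatest_max' hs
      obtain ⟨v, v', hv, hv', hle⟩ := ih _ hb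
      set b := s.max' hs
      have hbm : b < m := has b hb.1
      obtain ⟨v₁, hv₁, hn₁⟩ := hv.exists_insert hk hb hbm
      obtain ⟨v₂, hv₂, hn₂⟩ := hv'.exists_insert hk hb hbm
      refine ⟨v₁, v₂, hv₁, hv₂, ?_⟩
      have hr0 : 0 < Real.exp (b - m) := Real.exp_pos _
      have hr1 : Real.exp (b - m) < 1 := by simpa using hbm
      rw [sub_mul_sq_div_one_sub_sq hr0 hr1] at hn₁ hn₂
      generalize Real.exp (b - m) = r at *
      have e1 : r / (1 - r ^ 2) * (w m - w b) ^ 2 ≤ r / (1 - r ^ 2) * (u m - u b) ^ 2 :=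
        mul_le_mul_of_nonneg_left (sq_le_sq.mpr (hd m b)) (div_nonneg hr0.le (by nlinarith))
      have e2 : (1 - r) / (2 * (1 + r)) * (w m ^ 2 + w b ^ 2) ≤
          (1 - r) / (2 * (1 + r)) * (u m ^ 2 + u b ^ 2) :=
        mul_le_mul_of_nonneg_left (add_le_add (sq_le_sq.mpr (hw m)) (sq_le_sq.mpr (hw b)))
          (div_nonneg (by linarith) (by linarith))
      -- The terms `u m ^ 2 / 2 - u b ^ 2 / 2` of the splitting, and those for `w`, telescope with
      -- the correction at the last point.
      linarith

/-- The Laplace space is stable under normal contractions. -/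
theorem exists_laplaceRKHS_eq_contraction (g : LaplaceRKHS) {w : ℝ → ℝ}
    (hw : ∀ x, |w x| ≤ |g x|) (hd : ∀ x y, |w x - w y| ≤ |g x - g y|) :
    ∃ v : LaplaceRKHS, ∀ x, v x = w x := by
  have eval : ∀ (f : LaplaceRKHS) x, ⟪RKHS.kerFun LaplaceRKHS x (1 : ℝ), f⟫_ℝ = f x := by
    intro f x
    rw [RKHS.kerFun_inner]
    simp
  have hk : ∀ x y, ⟪RKHS.kerFun LaplaceRKHS x (1 : ℝ), RKHS.kerFun LaplaceRKHS y (1 : ℝ)⟫_ℝ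
      = laplaceKernel x y := by
    intro x y
    rw [eval, RKHS.kerFun_apply, RKHS.OfKernel.kernel_ofKernel]
    simp [kernelMatrix]
  obtain ⟨v, hv⟩ := exists_forall_inner_eq_of_finset
    (fun x => RKHS.kerFun LaplaceRKHS x (1 : ℝ)) w ‖g‖ fun s => by
      rcases s.eq_empty_or_nonempty with rfl | hs
      · exact ⟨0, by simp, by simp⟩
      obtain ⟨v, v', hv, hv', hle⟩ := exists_isMinimalInterpolant_contraction hk hw hd s _
        (s.isGreatest_max' hs)
      refine ⟨v', ?_, hv'.1⟩
      refine le_of_sq_le_sq ?_ (norm_nonneg g)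
      linarith [hv.norm_sq_le fun x _ => eval g x, sq_le_sq.mpr (hw (s.max' hs))]
  exact ⟨v, fun x => by rw [← eval, hv]⟩

/-- The class `F` is stable under post-processing by 1-Lipschitz functions. -/
theorem add_comp_mem_laplaceClass {f : ℝ → ℝ} (hf : f ∈ laplaceClass) {φ : ℝ → ℝ}
    (hφ : LipschitzWith 1 φ) : (fun x => f x + φ (f x)) ∈ laplaceClass := by
  obtain ⟨g, b, hg⟩ := hf
  have hlip : ∀ s t, |φ s - φ t| ≤ |s - t| := fun s t => by
    simpa [Real.dist_eq] using hφ.dist_le_mul s t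
  -- Subtracting `φ b` makes the contraction vanish where `g` does; the constant goes into the
  -- summand `ℝ`.
  obtain ⟨v, hv⟩ := exists_laplaceRKHS_eq_contraction g (w := fun x => φ (g x + b) - φ b)
    (fun x => by simpa using hlip (g x + b) b)
    (fun x y => by simpa using hlip (g x + b) (g y + b))
  refine ⟨g + v, b + φ b, fun x => ?_⟩
  simp only [RKHS.coe_add, Pi.add_apply, hv, hg]
  ring

/-- `F` is closed under post-processing. First conjunct: predictors `f ∈ F` with values in
`[0, 1]`, post-processed by 1-Lipschitz `h : [0, 1] → [-1, 1]`. Second conjunct: arbitrary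
`f ∈ F`, post-processed by 1-Lipschitz `h : ℝ → [-1, 1]`. -/
theorem mainTheorem3 :
    (∀ f ∈ laplaceClass, ∀ hf : ∀ x, f x ∈ Icc (0 : ℝ) 1, ∀ h ∈ Lip1 (Icc (0 : ℝ) 1),
      (fun x => f x + (h ⟨f x, hf x⟩ : ℝ)) ∈ laplaceClass) ∧
    (∀ f ∈ laplaceClass, ∀ h ∈ Lip1 univ,
      (fun x => f x + (h ⟨f x, mem_univ _⟩ : ℝ)) ∈ laplaceClass) := by
  refine ⟨fun f hF hf h hh => ?_, fun f hF h hh => ?_⟩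
  -- Composing with the projection onto `[0, 1]` extends `h` to `ℝ` as a 1-Lipschitz function.
  · have hφ : LipschitzWith 1 fun t => (h (projIcc 0 1 zero_le_one t) : ℝ) := by
      simpa [Function.comp_def] using (LipschitzWith.subtype_val _).comp
        (LipschitzWith.comp hh (LipschitzWith.projIcc zero_le_one))
    have hmem := add_comp_mem_laplaceClass hF hφ
    simpa only [projIcc_of_mem zero_le_one (hf _)] using hmem
  · have hφ : LipschitzWith 1 fun t => (h ⟨t, mem_univ t⟩ : ℝ) :=
      fun s t => hh ⟨s, mem_univ s⟩ ⟨t, mem_univ t⟩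
    exact add_comp_mem_laplaceClass hF hφ
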